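/- Let $\varphi:\mathbb{R}^n\to(-\infty,+\infty]$ be proper and lower semicontinuous, $\mathrm{dom}\,\varphi=\{x:\varphi(x)<+\infty\}$, and let $\partial\varphi$ be its limiting subdifferential: with $\hat\partial\varphi(x)=\{u:\liminf_{y\to x,\,y\ne x}\frac{\varphi(y)-\varphi(x)-\langle u,y-x\rangle}{\|y-x\|}\ge 0\}$ for $x\in\mathrm{dom}\,\varphi$ and $\hat\partial\varphi(x)=\emptyset$ otherwise, $u\in\partial\varphi(x)$ means that there are $x^k\to x$ and $u^k\to u$ with $\varphi(x^k)\to\varphi(x)$ and $u^k\in\hat\partial\varphi(x^k)$. Let $\mathrm{crit}\,\varphi=\{x:0\in\partial\varphi(x)\}$. Assume that $\varphi$ achieves its minimum $\min\varphi$ and that $\mathrm{crit}\,\varphi$ is nonempty and closed. Put $d(x)=\inf_{u\in\mathrm{crit}\,\varphi}\|x-u\|$ and $\mathcal P_\varphi(x)=\{u\in\mathrm{crit}\,\varphi:\|x-u\|=d(x)\}$. Let $\Omega\subset X\subset\mathbb{R}^n$, and let $G_\varphi:X\to\mathbb{R}^n$ be a residual measure operator, i.e. $\{x\in X:G_\varphi(x)=0\}=\mathrm{crit}\,\varphi$.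 Consider the following conditions, each required for all $x\in\Omega\cap\mathrm{dom}\,\varphi$, with positive constants $\kappa,\nu,\alpha,\eta,\omega$: - (res-EB) $\|G_\varphi(x)\|\ge\kappa\, d(x)$; - (cor-EB) $\inf_{p\in\mathcal P_\varphi(x)}\langle G_\varphi(x),x-p\rangle\ge\nu\, d(x)^2$; - (obj-EB) $\varphi(x)-\min\varphi\ge\frac{\alpha}{2}d(x)^2$; - (res-obj-EB) $\|G_\varphi(x)\|\ge\eta\sqrt{\varphi(x)-\min\varphi}$; - (cor-obj-EB) $\inf_{p\in\mathcal P_\varphi(x)}\langle G_\varphi(x),x-p\rangle\ge\omega(\varphi(x)-\min\varphi)$. Assume that (cor-obj-EB) holds with constant $\omega>0$. Then: 1. (obj-EB) with constant $\alpha$ implies (cor-EB) with $\nu=\alpha\omega/2$; (cor-EB) with constant $\nu$ implies (res-EB) with $\kappa=\nu$; (res-EB) with constant $\kappa$ implies (res-obj-EB) with $\eta=\sqrt{\kappa\omega}$. 2. Suppose moreover that $\varphi$ is convex; that $\|G_\varphi(x)\|\le\inf_{g\in\partial\varphi(x)}\|g\|$ for all $x\in\Omega\cap\mathrm{dom}\,\varphi$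 (with $\inf\emptyset=+\infty$); and that $\Omega$ is $\partial\varphi$-invariant in the following sense: for every $x\in\Omega\cap\mathrm{dom}\,\varphi$, the absolutely continuous (on bounded intervals) curve $\chi_x:[0,\infty)\to\mathbb{R}^n$ with $\chi_x(0)=x$ and $\dot\chi_x(t)\in-\partial\varphi(\chi_x(t))$ for a.e. $t>0$ satisfies $\chi_x(t)\in\Omega$ for a.e. $t>0$. Then (res-obj-EB) with constant $\eta$ implies (obj-EB) with $\alpha=\frac12\eta^2$, and hence (obj-EB), (cor-EB), (res-EB), (res-obj-EB), each for some positive constant, are equivalent. -/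

import Mathlib

open scoped Topology

namespace ErrorBound

noncomputable section

variable {n : ℕ}

/-- The effective domain of an extended-real-valued function. -/
def dom (f : EuclideanSpace ℝ (Fin n) → EReal) : Set (EuclideanSpace ℝ (Fin n)) :=
  {x | f x < ⊤}

/-- The class `Γ(ℝⁿ)`: proper lower semicontinuous functions `ℝⁿ → (-∞, +∞]`. -/
structure IsGamma (f : EuclideanSpace ℝ (Fin n) → EReal) : Prop where
  ne_bot : ∀ x, f x ≠ ⊥
  dom_nonempty : (dom f).Nonempty
  lsc : LowerSemicontinuous f

/-- The class `Γ₀(ℝⁿ)`: proper lower semicontinuous convex functions; convexity means that the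
epigraph is convex. -/
structure IsGammaZero (f : EuclideanSpace ℝ (Fin n) → EReal) : Prop extends IsGamma f where
  convex : Convex ℝ {p : EuclideanSpace ℝ (Fin n) × ℝ | f p.1 ≤ (p.2 : EReal)}

/-- The Fréchet subdifferential: for `x ∈ dom f`, all `u` with
`liminf_{y → x, y ≠ x} (f y - f x - ⟪u, y - x⟫) / ‖y - x‖ ≥ 0`, i.e. for each `ε > 0` the quotient
is at least `-ε` for `y` near `x` (at `y = x` the inequality below is trivial);
empty for `x ∉ dom f`. -/
def frechetSubdiff (f : EuclideanSpace ℝ (Fin n) → EReal) (x : EuclideanSpace ℝ (Fin n)) :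
    Set (EuclideanSpace ℝ (Fin n)) :=
  {u | x ∈ dom f ∧ ∀ ε : ℝ, 0 < ε →
    ∀ᶠ y in 𝓝 x, f x + ((inner ℝ u (y - x) - ε * ‖y - x‖ : ℝ) : EReal) ≤ f y}

/-- The limiting subdifferential `∂f(x)`. -/
def subdiff (f : EuclideanSpace ℝ (Fin n) → EReal) (x : EuclideanSpace ℝ (Fin n)) :
    Set (EuclideanSpace ℝ (Fin n)) :=
  {u | ∃ (xs us : ℕ → EuclideanSpace ℝ (Fin n)),
    Filter.Tendsto xs Filter.atTop (𝓝 x) ∧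
    Filter.Tendsto (fun k => f (xs k)) Filter.atTop (𝓝 (f x)) ∧
    (∀ k, us k ∈ frechetSubdiff f (xs k)) ∧
    Filter.Tendsto us Filter.atTop (𝓝 u)}

/-- The set of critical points. -/
def crit (f : EuclideanSpace ℝ (Fin n) → EReal) : Set (EuclideanSpace ℝ (Fin n)) :=
  {x | 0 ∈ subdiff f x}

/-- `f` achieves its minimum. -/
def AchievesMin (f : EuclideanSpace ℝ (Fin n) → EReal) : Prop :=
  ∃ x, ∀ y, f x ≤ f y

/-- The objective value error `f x - min f`; used only for `x ∈ dom f` and for `f` in `Γ(ℝⁿ)` that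
achieves its minimum, so that both terms are real numbers. -/
def objError (f : EuclideanSpace ℝ (Fin n) → EReal) (x : EuclideanSpace ℝ (Fin n)) : ℝ :=
  (f x).toReal - (⨅ y, f y).toReal

/-- The projection operator onto the critical point set. -/
def projCrit (f : EuclideanSpace ℝ (Fin n) → EReal) (x : EuclideanSpace ℝ (Fin n)) :
    Set (EuclideanSpace ℝ (Fin n)) :=
  {u | u ∈ crit f ∧ ∀ v ∈ crit f, ‖x - u‖ ≤ ‖x - v‖}

/-- `G` is a residual measure operator related to `f` and `X`. Only the values of `G` on `X`
matter. -/
def IsResidualMeasureOperator (f : EuclideanSpace ℝ (Fin n) → EReal)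
    (X : Set (EuclideanSpace ℝ (Fin n)))
    (G : EuclideanSpace ℝ (Fin n) → EuclideanSpace ℝ (Fin n)) : Prop :=
  {x | x ∈ X ∧ G x = 0} = crit f

/-- The least correlated error, the infimum of `⟪G x, x - p⟫` over the projections `p` of `x` onto
the critical point set (when that set is nonempty and closed, the projections form a nonempty
compact set, so that the infimum is a genuine one). -/
def leastCorrError (f : EuclideanSpace ℝ (Fin n) → EReal)
    (G : EuclideanSpace ℝ (Fin n) → EuclideanSpace ℝ (Fin n))
    (x : EuclideanSpace ℝ (Fin n)) : ℝ :=
  ⨅ p : projCrit f x, inner ℝ (G x) (x - (p : EuclideanSpace ℝ (Fin n)))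

/-- The `(G, κ, Ω)`-(res-EB) condition. -/
def ResEB (f : EuclideanSpace ℝ (Fin n) → EReal)
    (G : EuclideanSpace ℝ (Fin n) → EuclideanSpace ℝ (Fin n)) (κ : ℝ)
    (Ω : Set (EuclideanSpace ℝ (Fin n))) : Prop :=
  0 < κ ∧ ∀ x ∈ Ω ∩ dom f, κ * Metric.infDist x (crit f) ≤ ‖G x‖

/-- The `(G, ν, Ω)`-(cor-EB) condition. -/
def CorEB (f : EuclideanSpace ℝ (Fin n) → EReal)
    (G : EuclideanSpace ℝ (Fin n) → EuclideanSpace ℝ (Fin n)) (ν : ℝ)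
    (Ω : Set (EuclideanSpace ℝ (Fin n))) : Prop :=
  0 < ν ∧ ∀ x ∈ Ω ∩ dom f, ν * Metric.infDist x (crit f) ^ 2 ≤ leastCorrError f G x

/-- The `(f, α, Ω)`-(obj-EB) condition. -/
def ObjEB (f : EuclideanSpace ℝ (Fin n) → EReal) (α : ℝ)
    (Ω : Set (EuclideanSpace ℝ (Fin n))) : Prop :=
  0 < α ∧ ∀ x ∈ Ω ∩ dom f, α / 2 * Metric.infDist x (crit f) ^ 2 ≤ objError f x

/-- The `(G, η, Ω)`-(res-obj-EB) condition. -/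
def ResObjEB (f : EuclideanSpace ℝ (Fin n) → EReal)
    (G : EuclideanSpace ℝ (Fin n) → EuclideanSpace ℝ (Fin n)) (η : ℝ)
    (Ω : Set (EuclideanSpace ℝ (Fin n))) : Prop :=
  0 < η ∧ ∀ x ∈ Ω ∩ dom f, η * √(objError f x) ≤ ‖G x‖

/-- The `(G, ω, Ω)`-(cor-obj-EB) condition. -/
def CorObjEB (f : EuclideanSpace ℝ (Fin n) → EReal)
    (G : EuclideanSpace ℝ (Fin n) → EuclideanSpace ℝ (Fin n)) (ω : ℝ)
    (Ω : Set (EuclideanSpace ℝ (Fin n))) : Prop :=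
  0 < ω ∧ ∀ x ∈ Ω ∩ dom f, ω * objError f x ≤ leastCorrError f G x

/-- `χ` restricted to `[0, ∞)` is a (locally) absolutely continuous curve with `χ 0 = x` and
`χ'(t) ∈ -∂f(χ(t))` for almost every `t > 0`. -/
structure IsSubgradientCurve (f : EuclideanSpace ℝ (Fin n) → EReal)
    (x : EuclideanSpace ℝ (Fin n)) (χ : ℝ → EuclideanSpace ℝ (Fin n)) : Prop where
  init : χ 0 = x
  absCont : ∀ T : ℝ, 0 < T → AbsolutelyContinuousOnInterval χ 0 T
  deriv_mem : ∀ᵐ t : ℝ, 0 < t → ∃ v ∈ subdiff f (χ t), HasDerivAt χ (-v) t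

/-- `Ω` is `∂f`-invariant: for each `x ∈ Ω ∩ dom f`, the subgradient curve of `f` that starts at
`x` is in `Ω` at almost every time `t > 0`. (For `f` in `Γ₀(ℝⁿ)` this curve exists and is unique on
`[0, ∞)`; neither fact is assumed here.) -/
def SubdiffInvariant (f : EuclideanSpace ℝ (Fin n) → EReal)
    (Ω : Set (EuclideanSpace ℝ (Fin n))) : Prop :=
  ∀ x ∈ Ω ∩ dom f, ∀ χ : ℝ → EuclideanSpace ℝ (Fin n), IsSubgradientCurve f x χ →
    ∀ᵐ t : ℝ, 0 < t → χ t ∈ Ω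

end

end ErrorBound

/-! Write F = φ - min φ and d for the distance to `crit φ`. Cauchy–Schwarz at a single projection
gives ω F ≤ least correlated error ≤ ‖G‖ d (`leastCorrError_le`), and the implications of item 1 are
algebra on this chain.

For item 2, follow the gradient flow u of φ from x. By invariance and the bound on G, almost every
velocity satisfies ‖u'‖ ≥ ‖G(u)‖ ≥ η √F(u), while F(u)' = -‖u'‖² where both derivatives exist. Hence
-(√F(u))' ≥ (η/2) ‖u'‖ as long as F(u) > 0, and the displacement never exceeds (2/η) √F(x)
(`IsEVICurve.norm_sub_le`). Since F(u t) → 0, lower semicontinuity puts a minimizer, hence a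
critical point, in that closed ball: d(x) ≤ (2/η) √F(x), which is (obj-EB) with α = η²/2.

The flow is built as a limit of proximal iterations. Its evolution variational inequality (EVI)
yields absolute continuity, the subgradient inclusion, the energy identity and the decay of F.
Invariance concerns every subgradient curve, so existence of one suffices. -/

namespace ErrorBound

open Set Filter MeasureTheory

/-! ### Proximal points, the implicit Euler scheme and its limit -/

section Proximal

variable {V : Type*} [NormedAddCommGroup V] [InnerProductSpace ℝ V] [ProperSpace V]

/-- The proximal point of a closed convex epigraph `E`, with its variational inequality. -/
lemma exists_proximal_point {E : Set (V × ℝ)} (hcl : IsClosed E) (hconv : Convex ℝ E) {m : ℝ}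
    (hm : ∀ p ∈ E, m ≤ p.2) (hne : E.Nonempty) (x : V) {h : ℝ} (hh : 0 < h) :
    ∃ p ∈ E, ∀ q ∈ E, p.2 + (‖p.1 - x‖ ^ 2 + ‖q.1 - p.1‖ ^ 2) / (2 * h) ≤
      q.2 + ‖q.1 - x‖ ^ 2 / (2 * h) := by
  obtain ⟨p0, hp0⟩ := hne
  let Ψ : V × ℝ → ℝ := fun p => p.2 + ‖p.1 - x‖ ^ 2 / (2 * h)
  have hΨ : Continuous Ψ := by fun_prop
  -- Heights are at least `m`, so a bound on `Ψ` bounds both coordinates.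
  have hcomp : IsCompact (E ∩ {p | Ψ p ≤ Ψ p0}) := by
    refine ((isCompact_closedBall x (√((Ψ p0 - m) * (2 * h)))).prod
      (isCompact_Icc (a := m) (b := Ψ p0))).of_isClosed_subset
      (hcl.inter (isClosed_le hΨ continuous_const)) ?_
    rintro p ⟨hpE, hp⟩
    have h1 := hm p hpE
    have h2 : 0 ≤ ‖p.1 - x‖ ^ 2 / (2 * h) := by positivity
    have h3 : p.2 + ‖p.1 - x‖ ^ 2 / (2 * h) ≤ Ψ p0 := hp
    refine ⟨?_, h1, by linarith⟩
    rw [Metric.mem_closedBall, dist_eq_norm]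
    apply Real.le_sqrt_of_sq_le
    rw [← div_le_iff₀ (by positivity)]
    linarith
  obtain ⟨p, ⟨hpE, hp⟩, hpmin⟩ := hcomp.exists_isMinOn ⟨p0, hp0, mem_ofPred.2 le_rfl⟩ hΨ.continuousOn
  have hmin : ∀ q ∈ E, Ψ p ≤ Ψ q := fun q hq => by
    by_cases hq' : Ψ q ≤ Ψ p0
    · exact hpmin ⟨hq, hq'⟩
    · exact le_trans hp (not_le.1 hq').le
  refine ⟨p, hpE, fun q hq => ?_⟩
  set I : ℝ := inner ℝ (p.1 - x) (q.1 - p.1) with hI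
  have hexp : ∀ θ : ℝ, ‖(p.1 - x) + θ • (q.1 - p.1)‖ ^ 2 =
      ‖p.1 - x‖ ^ 2 + 2 * θ * I + θ ^ 2 * ‖q.1 - p.1‖ ^ 2 := fun θ => by
    rw [norm_add_sq_real, inner_smul_right, norm_smul, mul_pow, Real.norm_eq_abs, sq_abs]
    ring
  -- Minimality against the segment from `p` to `q`, divided by θ; θ → 0 gives the first-order
  -- condition, and `hexp 1` turns its inner product into squares.
  have hθ : ∀ θ : ℝ, 0 < θ → θ ≤ 1 →
      0 ≤ q.2 - p.2 + I / h + θ * (‖q.1 - p.1‖ ^ 2 / (2 * h)) := fun θ h0 h1 => by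
    have hmem := hconv hpE hq (sub_nonneg.2 h1) h0.le (by ring)
    have := hmin _ hmem
    simp only [Ψ, Prod.fst_add, Prod.snd_add, Prod.smul_fst, Prod.smul_snd, smul_eq_mul] at this
    rw [show (1 - θ) • p.1 + θ • q.1 - x = (p.1 - x) + θ • (q.1 - p.1) by module, hexp] at this
    have h2 : 0 ≤ θ * (q.2 - p.2 + I / h + θ * (‖q.1 - p.1‖ ^ 2 / (2 * h))) := by
      have : θ * (q.2 - p.2 + I / h + θ * (‖q.1 - p.1‖ ^ 2 / (2 * h))) =
        ((1 - θ) * p.2 + θ * q.2 + (‖p.1 - x‖ ^ 2 + 2 * θ * I + θ ^ 2 * ‖q.1 - p.1‖ ^ 2) / (2 * h))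
        - (p.2 + ‖p.1 - x‖ ^ 2 / (2 * h)) := by field_simp; ring
      linarith
    exact nonneg_of_mul_nonneg_right h2 h0
  have hlim : 0 ≤ q.2 - p.2 + I / h := by
    have ht : Tendsto (fun θ : ℝ => q.2 - p.2 + I / h + θ * (‖q.1 - p.1‖ ^ 2 / (2 * h)))
        (𝓝[>] 0) (𝓝 (q.2 - p.2 + I / h + 0 * (‖q.1 - p.1‖ ^ 2 / (2 * h)))) :=
      (Continuous.tendsto (by fun_prop) 0).mono_left nhdsWithin_le_nhds
    rw [zero_mul, add_zero] at ht
    refine ge_of_tendsto ht ?_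
    filter_upwards [Ioc_mem_nhdsGT (zero_lt_one (α := ℝ))] with θ h using hθ θ h.1 h.2
  have h1 := hexp 1
  rw [one_smul, sub_add_sub_cancel'] at h1
  rw [h1]
  have : q.2 + (‖p.1 - x‖ ^ 2 + 2 * 1 * I + 1 ^ 2 * ‖q.1 - p.1‖ ^ 2) / (2 * h) -
      (p.2 + (‖p.1 - x‖ ^ 2 + ‖q.1 - p.1‖ ^ 2) / (2 * h)) = q.2 - p.2 + I / h := by
    field_simp; ring
  linarith

/-- The proximal point algorithm on a closed convex epigraph and its discrete evolution
variational inequality. -/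
lemma exists_proximal_sequence {E : Set (V × ℝ)} (hcl : IsClosed E) (hconv : Convex ℝ E) {m : ℝ}
    (hm : ∀ p ∈ E, m ≤ p.2) {p₀ : V × ℝ} (hp₀ : p₀ ∈ E) {h : ℝ} (hh : 0 < h) :
    ∃ P : ℕ → V × ℝ, P 0 = p₀ ∧ (∀ k, P k ∈ E) ∧ Antitone (fun k => (P k).2) ∧
      ∀ k l : ℕ, k ≤ l → ∀ q ∈ E, ‖q.1 - (P l).1‖ ^ 2 - ‖q.1 - (P k).1‖ ^ 2 ≤
        2 * (l * h - k * h) * (q.2 - (P l).2) := by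
  choose J hJE hJ using fun x : V => exists_proximal_point hcl hconv hm ⟨p₀, hp₀⟩ x hh
  let P : ℕ → V × ℝ := fun k => (fun p => J p.1)^[k] p₀
  have hsucc : ∀ k, P (k + 1) = J (P k).1 := fun k => Function.iterate_succ_apply' _ _ _
  have hE : ∀ k, P k ∈ E := by
    rintro (_ | k)
    · exact hp₀
    · rw [hsucc]; exact hJE _
  have hstep : ∀ k, ∀ q ∈ E, ‖q.1 - (P (k + 1)).1‖ ^ 2 - ‖q.1 - (P k).1‖ ^ 2 +
      ‖(P (k + 1)).1 - (P k).1‖ ^ 2 ≤ 2 * h * (q.2 - (P (k + 1)).2) := fun k q hq => by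
    have := hJ (P k).1 q hq
    rw [← hsucc] at this
    have h2 : ∀ a b c d e : ℝ, a + (b + c) / (2 * h) ≤ d + e / (2 * h) →
        c - e + b ≤ 2 * h * (d - a) := fun a b c d e H => by
      have : (c - e + b) / (2 * h) ≤ d - a := by
        rw [show (c - e + b) / (2 * h) = (b + c) / (2 * h) - e / (2 * h) by ring]; linarith
      rw [div_le_iff₀ (by positivity)] at this
      linarith
    exact h2 _ _ _ _ _ this
  have hanti : Antitone (fun k => (P k).2) := antitone_nat_of_succ_le fun k => by
    have := hstep k (P k) (hE k)
    rw [sub_self, norm_zero] at this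
    have h0 : 0 ≤ 2 * h * ((P k).2 - (P (k + 1)).2) := by
      refine le_trans ?_ this
      rw [norm_sub_rev]; ring_nf; positivity
    have := nonneg_of_mul_nonneg_right h0 (by positivity)
    linarith
  refine ⟨P, rfl, hE, hanti, fun k l hkl q hq => ?_⟩
  induction l, hkl using Nat.le_induction with
  | base => simp
  | succ l hkl ih =>
    have h1 := hstep l q hq
    have h2 := hanti (Nat.le_succ l)
    -- Since heights decrease, the earlier steps may also be charged with the final height.
    have h3 : (0 : ℝ) ≤ 2 * (l * h - k * h) := by
      have : (k : ℝ) ≤ l := by exact_mod_cast hkl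
      nlinarith
    have h4 : 2 * (l * h - k * h) * (q.2 - (P l).2) ≤
        2 * (l * h - k * h) * (q.2 - (P (l + 1)).2) :=
      mul_le_mul_of_nonneg_left (by simp only at h2; linarith) h3
    have h5 : 0 ≤ ‖(P (l + 1)).1 - (P l).1‖ ^ 2 := by positivity
    push_cast
    linarith

/-- The gradient flow on a closed convex epigraph, in the form of an evolution variational
inequality. -/
lemma exists_evi_curve {E : Set (V × ℝ)} (hcl : IsClosed E) (hconv : Convex ℝ E) {q₀ : V × ℝ}
    (hq₀ : q₀ ∈ E) (hm : ∀ p ∈ E, q₀.2 ≤ p.2) {p₀ : V × ℝ} (hp₀ : p₀ ∈ E) :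
    ∃ c : ℝ → V × ℝ, c 0 = p₀ ∧ (∀ t, c t ∈ E) ∧
      ∀ s t : ℝ, 0 ≤ s → s ≤ t → ∀ q ∈ E, ‖q.1 - (c t).1‖ ^ 2 - ‖q.1 - (c s).1‖ ^ 2 ≤
        2 * (t - s) * (q.2 - (c t).2) := by
  choose P hP0 hPE hPa hP using fun N : ℕ =>
    exists_proximal_sequence hcl hconv hm hp₀ (h := ((N : ℝ) + 1)⁻¹) (by positivity)
  let a : ℕ → ℝ → V × ℝ := fun N t => P N ⌊t * ((N : ℝ) + 1)⌋₊
  have hK : IsCompact (Metric.closedBall q₀.1 ‖q₀.1 - p₀.1‖ ×ˢ Icc q₀.2 p₀.2) :=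
    (isCompact_closedBall _ _).prod isCompact_Icc
  -- Tested at the lowest point `q₀`, the discrete inequality keeps the iterates within their
  -- initial distance of `q₀.1`.
  have haK : ∀ t N, a N t ∈ Metric.closedBall q₀.1 ‖q₀.1 - p₀.1‖ ×ˢ Icc q₀.2 p₀.2 := by
    intro t N
    have h1 := hP N 0 ⌊t * ((N : ℝ) + 1)⌋₊ (Nat.zero_le _) q₀ hq₀
    have h2 := hPa N (Nat.zero_le ⌊t * ((N : ℝ) + 1)⌋₊)
    have h3 := hm _ (hPE N ⌊t * ((N : ℝ) + 1)⌋₊)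
    simp only [hP0] at h1 h2
    refine ⟨?_, h3, h2⟩
    rw [Metric.mem_closedBall, dist_eq_norm, norm_sub_rev]
    refine (sq_le_sq₀ (norm_nonneg _) (norm_nonneg _)).1 ?_
    have h4 : 2 * ((⌊t * ((N : ℝ) + 1)⌋₊ : ℝ) * ((N : ℝ) + 1)⁻¹ - ((0 : ℕ) : ℝ) * ((N : ℝ) + 1)⁻¹) *
        (q₀.2 - (P N ⌊t * ((N : ℝ) + 1)⌋₊).2) ≤ 0 := by
      refine mul_nonpos_of_nonneg_of_nonpos ?_ (by linarith)
      rw [Nat.cast_zero, zero_mul, sub_zero]; positivity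
    linarith
  -- One ultrafilter gives limits at all times simultaneously, with no equicontinuity or subsequence
  -- argument.
  let U : Ultrafilter ℕ := hyperfilter ℕ
  have hU : (U : Filter ℕ) ≤ atTop := Nat.hyperfilter_le_atTop
  have hex : ∀ t, ∃ z, Tendsto (fun N => a N t) U (𝓝 z) := fun t => by
    obtain ⟨z, -, hz⟩ := hK.ultrafilter_le_nhds' (U.map fun N => a N t)
      (mem_map.2 (univ_mem' (haK t)))
    exact ⟨z, hz⟩
  choose c hc using hex
  refine ⟨c, ?_, fun t => ?_, fun s t hs hst q hq => ?_⟩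
  · refine tendsto_nhds_unique (hc 0) ?_
    simp only [a, zero_mul, Nat.floor_zero, hP0]
    exact tendsto_const_nhds
  · exact hcl.mem_of_tendsto (hc t) (Eventually.of_forall fun N => hPE _ _)
  · have hfl : ∀ r : ℝ, 0 ≤ r →
        Tendsto (fun N : ℕ => (⌊r * ((N : ℝ) + 1)⌋₊ : ℝ) * ((N : ℝ) + 1)⁻¹) U (𝓝 r) := by
      intro r hr
      have h1 := (tendsto_nat_floor_mul_div_atTop (R := ℝ) hr).comp
        (tendsto_atTop_add_const_right atTop (1 : ℝ) tendsto_natCast_atTop_atTop)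
      exact h1.mono_left hU
    have hfst : ∀ r, Tendsto (fun N => (a N r).1) U (𝓝 (c r).1) := fun r =>
      (continuous_fst.tendsto _).comp (hc r)
    have hsnd : ∀ r, Tendsto (fun N => (a N r).2) U (𝓝 (c r).2) := fun r =>
      (continuous_snd.tendsto _).comp (hc r)
    refine le_of_tendsto_of_tendsto
      ((((hfst t).const_sub q.1).norm.pow 2).sub (((hfst s).const_sub q.1).norm.pow 2))
      ((((hfl t (hs.trans hst)).sub (hfl s hs)).const_mul 2).mul ((hsnd t).const_sub q.2))
      (Eventually.of_forall fun N => hP N _ _ (Nat.floor_mono ?_) q hq)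
    gcongr

end Proximal

/-! ### Absolute continuity from a monotone energy -/

section Curve

/-- A monotone map sends disjoint intervals to intervals with disjoint spans inside (g 0, g T];
compare Lebesgue measures. -/
lemma sum_sub_le_of_monotoneOn {g : ℝ → ℝ} {T : ℝ} (hg : MonotoneOn g (Icc 0 T)) (hT : 0 ≤ T)
    {E : ℕ × (ℕ → ℝ × ℝ)} (hE : E ∈ AbsolutelyContinuousOnInterval.disjWithin 0 T) :
    ∑ i ∈ Finset.range E.1, |g (E.2 i).1 - g (E.2 i).2| ≤ g T - g 0 := by
  obtain ⟨hmem, hdisj⟩ := hE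
  rw [uIcc_of_le hT] at hmem
  have hgT : g 0 ≤ g T := hg ⟨le_rfl, hT⟩ ⟨hT, le_rfl⟩ hT
  have hd : Set.PairwiseDisjoint (Finset.range E.1 : Set ℕ)
      (fun i => uIoc (g (E.2 i).1) (g (E.2 i).2)) := by
    intro i hi j hj hij
    have := hdisj hi hj hij
    obtain ⟨hi1, hi2⟩ := hmem i hi
    obtain ⟨hj1, hj2⟩ := hmem j hj
    simp only [Function.onFun, uIoc, Set.Ioc_disjoint_Ioc] at this ⊢
    have key : ∀ {p q r s : ℝ}, p ∈ Icc 0 T → q ∈ Icc 0 T → r ∈ Icc 0 T → s ∈ Icc 0 T →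
        min (max p q) (max r s) ≤ max (min p q) (min r s) →
        min (max (g p) (g q)) (max (g r) (g s)) ≤ max (min (g p) (g q)) (min (g r) (g s)) := by
      intro p q r s hp hq hr hs h
      have hmax : ∀ {x y}, x ∈ Icc 0 T → y ∈ Icc 0 T → max (g x) (g y) = g (max x y) :=
        fun hx hy => (hg.map_max hx hy).symm
      have hmin : ∀ {x y}, x ∈ Icc 0 T → y ∈ Icc 0 T → min (g x) (g y) = g (min x y) :=
        fun hx hy => (hg.map_min hx hy).symm
      have m1 : ∀ {x y}, x ∈ Icc 0 T → y ∈ Icc 0 T → max x y ∈ Icc 0 T := fun hx hy => by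
        exact ⟨le_max_of_le_left hx.1, max_le hx.2 hy.2⟩
      have m2 : ∀ {x y}, x ∈ Icc 0 T → y ∈ Icc 0 T → min x y ∈ Icc 0 T := fun hx hy => by
        exact ⟨le_min hx.1 hy.1, min_le_of_left_le hx.2⟩
      rw [hmax hp hq, hmax hr hs, hmin hp hq, hmin hr hs, hmin (m1 hp hq) (m1 hr hs),
        hmax (m2 hp hq) (m2 hr hs)]
      exact hg (m2 (m1 hp hq) (m1 hr hs)) (m1 (m2 hp hq) (m2 hr hs)) h
    exact key hi1 hi2 hj1 hj2 this
  have hsub : (⋃ i ∈ Finset.range E.1, uIoc (g (E.2 i).1) (g (E.2 i).2)) ⊆ Ioc (g 0) (g T) := by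
    refine iUnion₂_subset fun i hi => ?_
    obtain ⟨h1, h2⟩ := hmem i hi
    have h0 : (0 : ℝ) ∈ Icc 0 T := ⟨le_rfl, hT⟩
    have hT' : T ∈ Icc 0 T := ⟨hT, le_rfl⟩
    exact Ioc_subset_Ioc (le_min (hg h0 h1 h1.1) (hg h0 h2 h2.1))
      (max_le (hg h1 hT' h1.2) (hg h2 hT' h2.2))
  have hvol := measure_mono (μ := volume) hsub
  rw [measure_biUnion_finset hd fun i _ => measurableSet_uIoc] at hvol
  simp only [uIoc, Real.volume_Ioc, max_sub_min_eq_abs] at hvol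
  rw [← ENNReal.ofReal_sum_of_nonneg fun _ _ => abs_nonneg _,
    ENNReal.ofReal_le_ofReal_iff (by linarith)] at hvol
  simpa only [abs_sub_comm] using hvol

/-- A curve whose squared increments are controlled by the elapsed time multiplied by the decrease
of a nonincreasing function is absolutely continuous. -/
lemma absolutelyContinuousOnInterval_of_sq_dist_le {X : Type*} [PseudoMetricSpace X] {u : ℝ → X}
    {e : ℝ → ℝ} {T K : ℝ} (hT : 0 ≤ T) (he : AntitoneOn e (Icc 0 T)) (hK : 0 ≤ K)
    (hu : ∀ s t, 0 ≤ s → s ≤ t → t ≤ T → dist (u s) (u t) ^ 2 ≤ K * (t - s) * (e s - e t)) :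
    AbsolutelyContinuousOnInterval u 0 T := by
  rw [absolutelyContinuousOnInterval_iff]
  intro ε hε
  have hD : 0 ≤ e 0 - e T := sub_nonneg.2 (he ⟨le_rfl, hT⟩ ⟨hT, le_rfl⟩ hT)
  set D := e 0 - e T
  -- Weight in Young's inequality √(K Δt Δe) ≤ (l K Δt + Δe / l) / 2. The extra 1 makes `l` positive
  -- and D / l strictly less than ε.
  let l : ℝ := (D + 1) / ε
  have hl : 0 < l := by positivity
  refine ⟨ε / (l * (K + 1)), by positivity, fun E hE hlen => ?_⟩
  have hsum := sum_sub_le_of_monotoneOn he.neg hT hE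
  have hpt : ∀ a b, a ∈ Icc 0 T → b ∈ Icc 0 T →
      dist (u a) (u b) ≤ (l * K * dist a b + |-e a - -e b| / l) / 2 := by
    intro a b ha hb
    wlog hab : a ≤ b generalizing a b with H
    · have := H b a hb ha (not_le.1 hab).le
      rwa [dist_comm, dist_comm b a, abs_sub_comm] at this
    have h1 := hu a b ha.1 hab hb.2
    have h2 := he ha hb hab
    rw [dist_comm a b, Real.dist_eq, abs_of_nonneg (sub_nonneg.2 hab),
      abs_of_nonpos (by linarith)]
    set p := l * K * (b - a)
    set q := -(-e a - -e b) / l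
    have hp : 0 ≤ p := mul_nonneg (mul_nonneg hl.le hK) (sub_nonneg.2 hab)
    have hq : 0 ≤ q := div_nonneg (by linarith) hl.le
    have hpq : K * (b - a) * (e a - e b) = p * q := by
      simp only [p, q]; field_simp; ring
    refine abs_le_of_sq_le_sq' (a := dist (u a) (u b)) ?_ (by positivity) |>.2
    nlinarith [sq_nonneg (p - q)]
  have hE' := hE.1
  rw [uIcc_of_le hT] at hE'
  calc ∑ i ∈ Finset.range E.1, dist (u (E.2 i).1) (u (E.2 i).2)
      ≤ ∑ i ∈ Finset.range E.1,
        (l * K * dist (E.2 i).1 (E.2 i).2 + |-e (E.2 i).1 - -e (E.2 i).2| / l) / 2 :=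
        Finset.sum_le_sum fun i hi => hpt _ _ (hE' i hi).1 (hE' i hi).2
    _ = (l * K * ∑ i ∈ Finset.range E.1, dist (E.2 i).1 (E.2 i).2 +
        (∑ i ∈ Finset.range E.1, |-e (E.2 i).1 - -e (E.2 i).2|) / l) / 2 := by
        rw [← Finset.sum_div, Finset.sum_add_distrib, Finset.mul_sum, Finset.sum_div]
    _ < ε := by
        have h1 : (∑ i ∈ Finset.range E.1, |-e (E.2 i).1 - -e (E.2 i).2|) / l < ε := by
          rw [div_lt_iff₀ hl]
          have : ε * l = D + 1 := by simp only [l]; field_simp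
          rw [this]
          have : -e T - -e 0 = D := by simp only [D]; ring
          linarith
        have h2 : l * K * ∑ i ∈ Finset.range E.1, dist (E.2 i).1 (E.2 i).2 ≤ ε := by
          calc _ ≤ l * K * (ε / (l * (K + 1))) := by gcongr
            _ = ε * (K / (K + 1)) := by field_simp
            _ ≤ ε * 1 := by
                gcongr
                rw [div_le_one (by positivity)]; linarith
            _ = ε := mul_one _
        linarith

lemma hasDerivAt_le_of_sub_le {g : ℝ → ℝ} {g' t c : ℝ} (hg : HasDerivAt g g' t)
    (h : ∀ᶠ s in 𝓝[<] t, g t - g s ≤ (t - s) * c) : g' ≤ c := by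
  have h1 := (hasDerivAt_iff_tendsto_slope.1 hg).mono_left
    (nhdsWithin_mono t (show Iio t ⊆ {t}ᶜ from fun s hs => ne_of_lt hs))
  refine le_of_tendsto h1 ?_
  filter_upwards [h, self_mem_nhdsWithin] with s hs hst
  have : 0 < t - s := sub_pos.2 hst
  rw [slope_comm, slope_def_field, div_le_iff₀ this]
  linarith

/-! ### Curves satisfying the EVI -/

variable {V : Type*} [NormedAddCommGroup V]

/-- `u` solves the evolution variational inequality of `F : S → ℝ`. -/
def IsEVICurve (S : Set V) (F : V → ℝ) (u : ℝ → V) : Prop :=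
  (∀ t, u t ∈ S) ∧ ∀ s t : ℝ, 0 ≤ s → s ≤ t → ∀ y ∈ S,
    ‖y - u t‖ ^ 2 - ‖y - u s‖ ^ 2 ≤ 2 * (t - s) * (F y - F (u t))

namespace IsEVICurve

variable {S : Set V} {F : V → ℝ} {u : ℝ → V}

lemma sq_dist_le (h : IsEVICurve S F u) {s t : ℝ} (hs : 0 ≤ s) (hst : s ≤ t) :
    dist (u s) (u t) ^ 2 ≤ 2 * (t - s) * (F (u s) - F (u t)) := by
  simpa [dist_eq_norm] using h.2 s t hs hst _ (h.1 s)

lemma antitoneOn (h : IsEVICurve S F u) : AntitoneOn (fun t => F (u t)) (Ici 0) := by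
  intro s hs t _ hst
  rcases hst.eq_or_lt with rfl | hlt
  · exact le_rfl
  have h1 := h.sq_dist_le hs hst
  have h2 : 0 ≤ 2 * (t - s) * (F (u s) - F (u t)) := le_trans (by positivity) h1
  have := nonneg_of_mul_nonneg_right h2 (by linarith)
  simp only
  linarith

lemma absCont (h : IsEVICurve S F u) {T : ℝ} (hT : 0 ≤ T) :
    AbsolutelyContinuousOnInterval u 0 T :=
  absolutelyContinuousOnInterval_of_sq_dist_le hT (h.antitoneOn.mono Icc_subset_Ici_self)
    zero_le_two fun _ _ hs hst _ => h.sq_dist_le hs hst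

variable [InnerProductSpace ℝ V]

/-- Lets the displacement be recovered by integrating only the scalar component along it. -/
lemma absCont_inner (h : IsEVICurve S F u) (w : V) {T : ℝ} (hT : 0 ≤ T) :
    AbsolutelyContinuousOnInterval (fun t => inner ℝ w (u t)) 0 T := by
  refine absolutelyContinuousOnInterval_of_sq_dist_le (K := ‖w‖ ^ 2 * 2) hT
    (h.antitoneOn.mono Icc_subset_Ici_self) (by positivity) fun s t hs hst _ => ?_
  rw [Real.dist_eq, ← inner_sub_right, mul_assoc, mul_assoc]
  calc |inner ℝ w (u s - u t)| ^ 2 ≤ (‖w‖ * ‖u s - u t‖) ^ 2 := by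
        gcongr; exact abs_real_inner_le_norm _ _
    _ = ‖w‖ ^ 2 * dist (u s) (u t) ^ 2 := by rw [mul_pow, dist_eq_norm]
    _ ≤ _ := by
        have := h.sq_dist_le hs hst
        rw [mul_assoc] at this
        gcongr

lemma ae_differentiableAt [FiniteDimensional ℝ V] (h : IsEVICurve S F u) :
    ∀ᵐ t : ℝ, 0 < t → DifferentiableAt ℝ u t := by
  have : LocallyBoundedVariationOn u (Ici 0) := by
    intro a b ha hb
    have h1 := (h.absCont (mem_Ici.1 hb)).boundedVariationOn
    rw [uIcc_of_le (mem_Ici.1 hb)] at h1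
    exact h1.mono fun x hx => ⟨hx.1, hx.2.2⟩
  filter_upwards [this.ae_differentiableWithinAt_of_mem] with t ht h0
  exact (ht h0.le).differentiableAt (Ici_mem_nhds h0)

/-- The negative velocity is a subgradient. -/
lemma subgradient_ineq (h : IsEVICurve S F u) {t : ℝ} (ht : 0 < t) {v : V}
    (hv : HasDerivAt u v t) {y : V} (hy : y ∈ S) :
    F (u t) + inner ℝ (-v) (y - u t) ≤ F y := by
  -- Divide the EVI on [s, t] by t - s and let s increase to t.
  have h1 : HasDerivAt (fun s => ‖y - u s‖ ^ 2) (2 * inner ℝ (y - u t) (-v)) t :=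
    (hv.const_sub y).norm_sq
  have h2 := hasDerivAt_le_of_sub_le (c := 2 * (F y - F (u t))) h1 (by
    filter_upwards [Ioo_mem_nhdsLT ht] with s hs
    have := h.2 s t hs.1.le hs.2.le y hy
    linarith)
  rw [real_inner_comm] at h2
  linarith

/-- Energy dissipation along the curve. -/
lemma deriv_energy (h : IsEVICurve S F u) {t : ℝ} (ht : 0 < t) {v : V}
    (hv : HasDerivAt u v t) {e' : ℝ} (he : HasDerivAt (fun s => F (u s)) e' t) :
    e' = -‖v‖ ^ 2 := by
  have h1 : HasDerivAt (fun s => inner ℝ (-v) (u s) - F (u s)) (inner ℝ (-v) v - e') t := by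
    refine HasDerivAt.sub ?_ he
    simpa using (hasDerivAt_const t (-v)).inner ℝ hv
  -- As -v is a subgradient at `u t`, this function of s is maximal at t; its vanishing derivative
  -- replaces a chain rule.
  have h2 : IsLocalMax (fun s => inner ℝ (-v) (u s) - F (u s)) t := by
    refine Eventually.of_forall fun s => ?_
    have := h.subgradient_ineq ht hv (h.1 s)
    rw [inner_sub_right] at this
    simp only
    linarith
  have h3 := h2.hasDerivAt_eq_zero h1
  rw [inner_neg_left, real_inner_self_eq_norm_sq] at h3
  linarith

/-- Under a Łojasiewicz inequality along the curve, the curve has bounded displacement. -/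
lemma norm_sub_le [FiniteDimensional ℝ V] (h : IsEVICurve S F u) (hF : ∀ t, 0 ≤ F (u t)) {η : ℝ}
    (hη : 0 < η) (hL : ∀ᵐ t : ℝ, 0 < t → ∀ v, HasDerivAt u v t → η * √(F (u t)) ≤ ‖v‖) {T : ℝ}
    (hT : 0 ≤ T) : ‖u T - u 0‖ ≤ 2 / η * √(F (u 0)) := by
  set w := u T - u 0 with hw
  -- Monotonicity of `W` suffices: it is differentiable a.e. and the integral of its derivative is
  -- at most its increment.
  let W : ℝ → ℝ := fun t => -√(F (u t))
  have hWm : MonotoneOn W (uIcc 0 T) := by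
    rw [uIcc_of_le hT]
    intro s hs t ht hst
    exact neg_le_neg (Real.sqrt_le_sqrt (h.antitoneOn hs.1 ht.1 hst))
  have hac := h.absCont_inner w hT
  have hae : ∀ᵐ t ∂(volume.restrict (Icc 0 T)),
      deriv (fun t => inner ℝ w (u t)) t ≤ ‖w‖ * (2 / η) * deriv W t := by
    rw [← restrict_Ioo_eq_restrict_Icc, ae_restrict_iff' measurableSet_Ioo]
    filter_upwards [hWm.ae_differentiableWithinAt_of_mem, h.ae_differentiableAt, hL]
      with t h1 h2 h3 ht
    rw [uIcc_of_le hT] at h1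
    have hW := ((h1 ⟨ht.1.le, ht.2.le⟩).differentiableAt (Icc_mem_nhds ht.1 ht.2)).hasDerivAt
    have hu := (h2 ht.1).hasDerivAt
    have hLt := h3 ht.1 _ hu
    have hinner : HasDerivAt (fun t => inner ℝ w (u t)) (inner ℝ w (deriv u t)) t := by
      simpa using (hasDerivAt_const t w).inner ℝ hu
    have hsq : ∀ s, W s * W s = F (u s) := fun s => by
      simp only [W, neg_mul_neg]; exact Real.mul_self_sqrt (hF s)
    have he : HasDerivAt (fun s => F (u s)) (deriv W t * W t + W t * deriv W t) t := by
      have := hW.mul hW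
      rwa [show W * W = fun s => F (u s) from funext hsq] at this
    have hdis := h.deriv_energy ht.1 hu he
    rw [hinner.deriv]
    refine (real_inner_le_norm _ _).trans ?_
    rw [mul_assoc]
    refine mul_le_mul_of_nonneg_left ?_ (norm_nonneg _)
    have hR : √(F (u t)) = -W t := by simp [W]
    rw [hR] at hLt
    -- At zero energy one cannot divide by √F, but `W` is maximal there and both derivatives vanish.
    rcases (Real.sqrt_nonneg (F (u t))).eq_or_lt with h0 | h0
    · have hW0 : W t = 0 := by simp only [W]; linarith
      rw [hW0] at hdis
      have hv : ‖deriv u t‖ = 0 := by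
        have : ‖deriv u t‖ ^ 2 = 0 := by linarith
        exact pow_eq_zero_iff two_ne_zero |>.1 this
      have hmax : IsLocalMax W t := Eventually.of_forall fun s => by
        rw [hW0]; simp [W]
      rw [hv, hmax.deriv_eq_zero, mul_zero]
    · rw [hR] at h0
      have h5 : ‖deriv u t‖ ^ 2 = 2 * (-W t) * deriv W t := by linarith
      rw [div_mul_eq_mul_div, le_div_iff₀ hη]
      have h6 : (-W t) * (‖deriv u t‖ * η) ≤ (-W t) * (2 * deriv W t) := by
        nlinarith [norm_nonneg (deriv u t)]
      exact le_of_mul_le_mul_left h6 h0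
  -- With `w` the displacement itself, the left side integrates to ‖w‖².
  have hint := intervalIntegral.integral_mono_ae_restrict hT hac.intervalIntegrable_deriv
    (hWm.intervalIntegrable_deriv.const_mul (‖w‖ * (2 / η))) hae
  rw [hac.integral_deriv_eq_sub, intervalIntegral.integral_const_mul, ← inner_sub_right, ← hw,
    real_inner_self_eq_norm_sq] at hint
  have hWi := hWm.intervalIntegral_deriv_mem_uIcc
  rw [uIcc_of_le (sub_nonneg.2 (hWm left_mem_uIcc right_mem_uIcc hT))] at hWi
  have hWle : ∫ t in (0 : ℝ)..T, deriv W t ≤ √(F (u 0)) := by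
    refine hWi.2.trans ?_
    have := Real.sqrt_nonneg (F (u T))
    simp only [W]; linarith
  rcases (norm_nonneg w).eq_or_lt with h0 | h0
  · rw [← h0]; positivity
  · have : ‖w‖ * ‖w‖ ≤ ‖w‖ * (2 / η * √(F (u 0))) := by
      rw [← sq]
      refine hint.trans ?_
      rw [mul_assoc]
      gcongr
    exact le_of_mul_le_mul_left this h0

end IsEVICurve

end Curve

/-! ### Minimizers, subgradients and the flow of φ -/

section Main

variable {n : ℕ} {φ : EuclideanSpace ℝ (Fin n) → EReal}

lemma IsGamma.coe_toReal (hφ : IsGamma φ) {x : EuclideanSpace ℝ (Fin n)} (hx : x ∈ dom φ) :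
    ((φ x).toReal : EReal) = φ x :=
  EReal.coe_toReal (ne_of_lt hx) (hφ.ne_bot x)

lemma IsGamma.mem_dom_of_isMin (hφ : IsGamma φ) {z : EuclideanSpace ℝ (Fin n)}
    (hz : ∀ y, φ z ≤ φ y) : z ∈ dom φ := by
  obtain ⟨x, hx⟩ := hφ.dom_nonempty
  exact lt_of_le_of_lt (hz x) hx

lemma iInf_eq_of_isMin {z : EuclideanSpace ℝ (Fin n)} (hz : ∀ y, φ z ≤ φ y) :
    ⨅ y, φ y = φ z :=
  le_antisymm (iInf_le _ _) (le_iInf hz)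

lemma IsGamma.objError_nonneg (hφ : IsGamma φ) (hmin : AchievesMin φ)
    {x : EuclideanSpace ℝ (Fin n)} (hx : x ∈ dom φ) : 0 ≤ objError φ x := by
  obtain ⟨z, hz⟩ := hmin
  rw [objError, iInf_eq_of_isMin hz]
  exact sub_nonneg.2 (EReal.toReal_le_toReal (hz x) (hφ.ne_bot z) (ne_of_lt hx))

lemma IsGamma.isMin_of_objError_le (hφ : IsGamma φ) (hmin : AchievesMin φ)
    {x : EuclideanSpace ℝ (Fin n)} (hx : x ∈ dom φ) (h : objError φ x ≤ 0) (y) : φ x ≤ φ y := by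
  obtain ⟨z, hz⟩ := hmin
  rw [objError, iInf_eq_of_isMin hz, sub_nonpos] at h
  refine le_trans ?_ (hz y)
  rw [← hφ.coe_toReal hx, ← hφ.coe_toReal (hφ.mem_dom_of_isMin hz)]
  exact_mod_cast h

lemma frechetSubdiff_subset_subdiff (x : EuclideanSpace ℝ (Fin n)) :
    frechetSubdiff φ x ⊆ subdiff φ x := fun u hu =>
  ⟨fun _ => x, fun _ => u, tendsto_const_nhds, tendsto_const_nhds, fun _ => hu, tendsto_const_nhds⟩

lemma IsGamma.mem_subdiff_of_forall_le (hφ : IsGamma φ) {x v : EuclideanSpace ℝ (Fin n)}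
    (hx : x ∈ dom φ) (h : ∀ y ∈ dom φ, (φ x).toReal + inner ℝ v (y - x) ≤ (φ y).toReal) :
    v ∈ subdiff φ x := by
  refine frechetSubdiff_subset_subdiff x ⟨hx, fun ε hε => Eventually.of_forall fun y => ?_⟩
  by_cases hy : y ∈ dom φ
  · rw [← hφ.coe_toReal hx, ← hφ.coe_toReal hy, ← EReal.coe_add, EReal.coe_le_coe_iff]
    have := h y hy
    have h2 : 0 ≤ ε * ‖y - x‖ := by positivity
    linarith
  · rw [show φ y = ⊤ from not_lt_top_iff.1 hy]
    exact le_top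

lemma IsGamma.mem_crit_of_isMin (hφ : IsGamma φ) {z : EuclideanSpace ℝ (Fin n)}
    (hz : ∀ y, φ z ≤ φ y) : z ∈ crit φ := by
  refine hφ.mem_subdiff_of_forall_le (hφ.mem_dom_of_isMin hz) fun y hy => ?_
  rw [inner_zero_left, add_zero]
  exact EReal.toReal_le_toReal (hz y) (hφ.ne_bot z) (ne_of_lt hy)

lemma IsGamma.isClosed_epigraph (hφ : IsGamma φ) :
    IsClosed {p : EuclideanSpace ℝ (Fin n) × ℝ | φ p.1 ≤ (p.2 : EReal)} :=
  hφ.lsc.isClosed_epigraph.preimage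
    (continuous_fst.prodMk (continuous_coe_real_ereal.comp continuous_snd))

/-- Existence of the gradient flow of a proper lower semicontinuous convex function that achieves
its minimum. -/
lemma IsGammaZero.exists_isEVICurve (hφ : IsGammaZero φ) (hmin : AchievesMin φ)
    {x : EuclideanSpace ℝ (Fin n)} (hx : x ∈ dom φ) :
    ∃ u, u 0 = x ∧ IsEVICurve (dom φ) (objError φ) u := by
  obtain ⟨z, hz⟩ := hmin
  have hzd := hφ.mem_dom_of_isMin hz
  obtain ⟨c, hc0, hcE, hc⟩ := exists_evi_curve hφ.isClosed_epigraph hφ.convex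
    (q₀ := (z, (φ z).toReal)) (hφ.coe_toReal hzd).ge
    (fun p hp => by
      have := (hz p.1).trans hp
      rwa [← hφ.coe_toReal hzd, EReal.coe_le_coe_iff] at this)
    (p₀ := (x, (φ x).toReal)) (hφ.coe_toReal hx).ge
  have hcd : ∀ t, (c t).1 ∈ dom φ := fun t => lt_of_le_of_lt (hcE t) (EReal.coe_lt_top _)
  refine ⟨fun t => (c t).1, by simp only [hc0], hcd, fun s t hs hst y hy => ?_⟩
  refine (hc s t hs hst (y, (φ y).toReal) (hφ.coe_toReal hy).ge).trans ?_
  -- The limit height may lie above the graph; lowering it to φ only weakens the inequality.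
  have h1 : (φ (c t).1).toReal ≤ (c t).2 := by
    have : φ (c t).1 ≤ ((c t).2 : EReal) := hcE t
    rwa [← hφ.coe_toReal (hcd t), EReal.coe_le_coe_iff] at this
  simp only [objError, sub_sub_sub_cancel_right]
  have h2 : 0 ≤ 2 * (t - s) := by linarith
  gcongr

lemma IsEVICurve.isSubgradientCurve (hφ : IsGamma φ)
    {u : ℝ → EuclideanSpace ℝ (Fin n)} (hu : IsEVICurve (dom φ) (objError φ) u) :
    IsSubgradientCurve φ (u 0) u where
  init := rfl
  absCont T hT := hu.absCont hT.le
  deriv_mem := by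
    filter_upwards [hu.ae_differentiableAt] with t ht h0
    refine ⟨-deriv u t, hφ.mem_subdiff_of_forall_le (hu.1 t) fun y hy => ?_, ?_⟩
    · have := hu.subgradient_ineq h0 (ht h0).hasDerivAt hy
      simp only [objError] at this
      linarith
    · rw [neg_neg]; exact (ht h0).hasDerivAt

/-- If some points of `dom φ` in a closed ball have arbitrarily small objective error, the ball
contains a critical point. -/
lemma IsGamma.infDist_crit_le (hφ : IsGamma φ) (hmin : AchievesMin φ)
    {x : EuclideanSpace ℝ (Fin n)} {r : ℝ}
    (h : ∀ ε > 0, ∃ y ∈ dom φ, dist y x ≤ r ∧ objError φ y ≤ ε) :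
    Metric.infDist x (crit φ) ≤ r := by
  obtain ⟨y₁, hy₁, hyr₁, -⟩ := h 1 one_pos
  obtain ⟨z, hzr, hz⟩ := (hφ.lsc.lowerSemicontinuousOn (Metric.closedBall x r)).exists_isMinOn
    ⟨y₁, hyr₁⟩ (isCompact_closedBall x r)
  have hzd : z ∈ dom φ := show φ z < ⊤ from (show φ z ≤ φ y₁ from hz hyr₁).trans_lt hy₁
  have hz0 : objError φ z ≤ 0 := by
    refine le_of_forall_pos_le_add fun ε hε => ?_
    obtain ⟨y, hy, hyr, hye⟩ := h ε hε
    have := EReal.toReal_le_toReal (hz hyr) (hφ.ne_bot z) (ne_of_lt hy)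
    simp only [objError] at hye ⊢
    linarith
  have hzc := hφ.mem_crit_of_isMin (hφ.isMin_of_objError_le hmin hzd hz0)
  refine (Metric.infDist_le_dist_of_mem hzc).trans ?_
  rw [dist_comm]; exact hzr

/-! ### Projections and the implications between error bounds -/

lemma projCrit_nonempty (hne : (crit φ).Nonempty) (hcl : IsClosed (crit φ))
    (x : EuclideanSpace ℝ (Fin n)) : (projCrit φ x).Nonempty := by
  obtain ⟨p, hp, hpx⟩ := hcl.exists_infDist_eq_dist hne x
  refine ⟨p, hp, fun v hv => ?_⟩
  rw [← dist_eq_norm, ← dist_eq_norm, ← hpx]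
  exact Metric.infDist_le_dist_of_mem hv

lemma norm_sub_eq_infDist_of_mem_projCrit {x p : EuclideanSpace ℝ (Fin n)}
    (hp : p ∈ projCrit φ x) : ‖x - p‖ = Metric.infDist x (crit φ) := by
  refine le_antisymm ((Metric.le_infDist ⟨p, hp.1⟩).2 fun {v} hv => ?_) ?_
  · rw [dist_eq_norm]; exact hp.2 v hv
  · rw [← dist_eq_norm]; exact Metric.infDist_le_dist_of_mem hp.1

lemma leastCorrError_le (hne : (crit φ).Nonempty) (hcl : IsClosed (crit φ))
    (G : EuclideanSpace ℝ (Fin n) → EuclideanSpace ℝ (Fin n)) (x : EuclideanSpace ℝ (Fin n)) :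
    leastCorrError φ G x ≤ ‖G x‖ * Metric.infDist x (crit φ) := by
  obtain ⟨p, hp⟩ := projCrit_nonempty hne hcl x
  -- Without a lower bound the real infimum would default to 0.
  have hbdd : BddBelow (range fun p : projCrit φ x =>
      (inner ℝ (G x) (x - (p : EuclideanSpace ℝ (Fin n))) : ℝ)) := by
    refine ⟨-(‖G x‖ * Metric.infDist x (crit φ)), ?_⟩
    rintro _ ⟨q, rfl⟩
    have := abs_real_inner_le_norm (G x) (x - (q : EuclideanSpace ℝ (Fin n)))
    rw [norm_sub_eq_infDist_of_mem_projCrit q.2] at this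
    exact neg_le_of_abs_le this
  refine (ciInf_le hbdd ⟨p, hp⟩).trans ?_
  rw [← norm_sub_eq_infDist_of_mem_projCrit hp]
  exact real_inner_le_norm _ _

variable {G : EuclideanSpace ℝ (Fin n) → EuclideanSpace ℝ (Fin n)}
  {Ω : Set (EuclideanSpace ℝ (Fin n))}

lemma ObjEB.corEB {α ω : ℝ} (h : ObjEB φ α Ω) (hω : CorObjEB φ G ω Ω) :
    CorEB φ G (α * ω / 2) Ω := by
  have hα := h.1
  have hω0 := hω.1
  refine ⟨by positivity, fun x hx => le_trans ?_ (hω.2 x hx)⟩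
  have := mul_le_mul_of_nonneg_left (h.2 x hx) hω0.le
  linarith

lemma CorEB.resEB {ν : ℝ} (h : CorEB φ G ν Ω) (hne : (crit φ).Nonempty)
    (hcl : IsClosed (crit φ)) : ResEB φ G ν Ω := by
  refine ⟨h.1, fun x hx => ?_⟩
  have h1 := (h.2 x hx).trans (leastCorrError_le hne hcl G x)
  rcases (Metric.infDist_nonneg (x := x) (s := crit φ)).eq_or_lt with h0 | h0
  · rw [← h0, mul_zero]; positivity
  · rw [sq, ← mul_assoc] at h1
    exact le_of_mul_le_mul_right h1 h0

/-- κ ω F ≤ κ ‖G‖ d ≤ ‖G‖². -/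
lemma ResEB.resObjEB {κ ω : ℝ} (h : ResEB φ G κ Ω) (hω : CorObjEB φ G ω Ω)
    (hne : (crit φ).Nonempty) (hcl : IsClosed (crit φ)) : ResObjEB φ G (√(κ * ω)) Ω := by
  have hκ := h.1
  have hω0 := hω.1
  refine ⟨Real.sqrt_pos.2 (by positivity), fun x hx => ?_⟩
  have h1 := (hω.2 x hx).trans (leastCorrError_le hne hcl G x)
  have h2 := h.2 x hx
  rw [← Real.sqrt_mul (by positivity)]
  refine Real.sqrt_le_iff.2 ⟨norm_nonneg _, ?_⟩
  calc κ * ω * objError φ x = κ * (ω * objError φ x) := by ring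
    _ ≤ κ * (‖G x‖ * Metric.infDist x (crit φ)) := by gcongr
    _ = ‖G x‖ * (κ * Metric.infDist x (crit φ)) := by ring
    _ ≤ ‖G x‖ * ‖G x‖ := by gcongr
    _ = ‖G x‖ ^ 2 := (sq _).symm

/-- The flow from x approaches the minimal value without leaving the ball of radius (2/η) √F(x);
squaring this bound on d gives the constant. -/
lemma ResObjEB.objEB {η : ℝ} (h : ResObjEB φ G η Ω) (hφ : IsGammaZero φ) (hmin : AchievesMin φ)
    (hinv : SubdiffInvariant φ Ω)
    (hG : ∀ x ∈ Ω ∩ dom φ, ‖G x‖ₑ ≤ ⨅ g ∈ subdiff φ x, ‖g‖ₑ) :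
    ObjEB φ (1 / 2 * η ^ 2) Ω := by
  have hη := h.1
  refine ⟨by positivity, fun x hx => ?_⟩
  obtain ⟨u, rfl, hu⟩ := hφ.exists_isEVICurve hmin hx.2
  have hcurve := hu.isSubgradientCurve hφ.toIsGamma
  have hF : ∀ t, 0 ≤ objError φ (u t) := fun t => hφ.objError_nonneg hmin (hu.1 t)
  have hL : ∀ᵐ t : ℝ, 0 < t → ∀ v, HasDerivAt u v t → η * √(objError φ (u t)) ≤ ‖v‖ := by
    filter_upwards [hinv _ hx u hcurve, hcurve.deriv_mem] with t h1 h2 h0 v hv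
    obtain ⟨g, hg, hgu⟩ := h2 h0
    have hmem : u t ∈ Ω ∩ dom φ := ⟨h1 h0, hu.1 t⟩
    refine (h.2 _ hmem).trans ?_
    have h3 : ‖G (u t)‖ₑ ≤ ‖g‖ₑ := (hG _ hmem).trans (iInf₂_le g hg)
    rw [hv.unique hgu, norm_neg]
    exact enorm_le_iff_norm_le.1 h3
  have hdist : Metric.infDist (u 0) (crit φ) ≤ 2 / η * √(objError φ (u 0)) := by
    refine hφ.infDist_crit_le hmin fun ε hε => ?_
    obtain ⟨z, hz⟩ := id hmin
    set D := ‖z - u 0‖ ^ 2 with hD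
    -- The EVI at a minimizer gives 2 T F(u T) ≤ D, so this time makes F(u T) ≤ ε; the extra 1 keeps
    -- it positive when D = 0.
    have hT : 0 < (D + 1) / (2 * ε) := by positivity
    refine ⟨u ((D + 1) / (2 * ε)), hu.1 _, ?_, ?_⟩
    · rw [dist_eq_norm]
      exact hu.norm_sub_le hF hη hL hT.le
    · have h1 := hu.2 0 _ le_rfl hT.le z (hφ.mem_dom_of_isMin hz)
      have hz0 : objError φ z = 0 := by rw [objError, iInf_eq_of_isMin hz, sub_self]
      rw [hz0, sub_zero, zero_sub, ← hD] at h1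
      have h2 : 0 ≤ ‖z - u ((D + 1) / (2 * ε))‖ ^ 2 := by positivity
      generalize objError φ (u ((D + 1) / (2 * ε))) = e at h1 ⊢
      have h3 : 2 * ((D + 1) / (2 * ε)) * e ≤ D := by linarith
      rw [show 2 * ((D + 1) / (2 * ε)) * e = (D + 1) * e / ε by field_simp,
        div_le_iff₀ hε] at h3
      have hD0 : 0 ≤ D := by positivity
      have : (D + 1) * e ≤ (D + 1) * ε := by linarith
      exact le_of_mul_le_mul_left this (by positivity)
  calc 1 / 2 * η ^ 2 / 2 * Metric.infDist (u 0) (crit φ) ^ 2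
      ≤ 1 / 2 * η ^ 2 / 2 * (2 / η * √(objError φ (u 0))) ^ 2 := by
        gcongr
        exact Metric.infDist_nonneg
    _ = objError φ (u 0) := by
        rw [mul_pow, Real.sq_sqrt (hF 0)]
        field_simp

end Main

end ErrorBound

theorem theorem4p1 {n : ℕ} (φ : EuclideanSpace ℝ (Fin n) → EReal)
    (hφ : ErrorBound.IsGamma φ) (hmin : ErrorBound.AchievesMin φ)
    (hcrit_ne : (ErrorBound.crit φ).Nonempty) (hcrit_cl : IsClosed (ErrorBound.crit φ))
    (X Ω : Set (EuclideanSpace ℝ (Fin n))) (hΩX : Ω ⊆ X)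
    (G : EuclideanSpace ℝ (Fin n) → EuclideanSpace ℝ (Fin n))
    (hG : ErrorBound.IsResidualMeasureOperator φ X G)
    (ω : ℝ) (hω : ErrorBound.CorObjEB φ G ω Ω) :
    (∀ α : ℝ, ErrorBound.ObjEB φ α Ω → ErrorBound.CorEB φ G (α * ω / 2) Ω) ∧
    (∀ ν : ℝ, ErrorBound.CorEB φ G ν Ω → ErrorBound.ResEB φ G ν Ω) ∧
    (∀ κ : ℝ, ErrorBound.ResEB φ G κ Ω → ErrorBound.ResObjEB φ G (√(κ * ω)) Ω) ∧
    (ErrorBound.IsGammaZero φ → ErrorBound.SubdiffInvariant φ Ω →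
      (∀ x ∈ Ω ∩ ErrorBound.dom φ, ‖G x‖ₑ ≤ ⨅ g ∈ ErrorBound.subdiff φ x, ‖g‖ₑ) →
      (∀ η : ℝ, ErrorBound.ResObjEB φ G η Ω → ErrorBound.ObjEB φ (1 / 2 * η ^ 2) Ω) ∧
      List.TFAE [
        ∃ α : ℝ, ErrorBound.ObjEB φ α Ω,
        ∃ ν : ℝ, ErrorBound.CorEB φ G ν Ω,
        ∃ κ : ℝ, ErrorBound.ResEB φ G κ Ω,
        ∃ η : ℝ, ErrorBound.ResObjEB φ G η Ω]) := by
  refine ⟨fun α h => h.corEB hω, fun ν h => h.resEB hcrit_ne hcrit_cl,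
    fun κ h => h.resObjEB hω hcrit_ne hcrit_cl, fun hφ₀ hinv hGle =>
      ⟨fun η h => h.objEB hφ₀ hmin hinv hGle, ?_⟩⟩
  tfae_have 1 → 2 := fun ⟨_, h⟩ => ⟨_, h.corEB hω⟩
  tfae_have 2 → 3 := fun ⟨_, h⟩ => ⟨_, h.resEB hcrit_ne hcrit_cl⟩
  tfae_have 3 → 4 := fun ⟨_, h⟩ => ⟨_, h.resObjEB hω hcrit_ne hcrit_cl⟩
  tfae_have 4 → 1 := fun ⟨_, h⟩ => ⟨_, h.objEB hφ₀ hmin hinv hGle⟩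
  tfae_finish
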